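/- Consider the following model of exploring finite connected simple graphs with an oblivious agent. Colors are natural numbers, where $0$ means "uncolored". A (zero-memory) algorithm is a function $\mathrm{move}$ that assigns to every pair $(c_0,E)$, where $c_0\in\mathbb{N}$ (the color of the current vertex) and $E\colon\mathbb{N}\to\mathbb{N}$ has finite support ($E(c)$ is the number of neighbors of color $c$), either $\mathrm{Stop}$ or a pair $(c_1,d)\in\mathbb{N}\times\mathbb{N}$ such that $E(d)>0$ and such that $c_1=c_0$ unless $c_0=0$. On a graph $G$, initially all vertices are uncolored and an adversary places the agent on a start vertex $v_0$. In each step, with the agent on a vertex $v$, the algorithm evaluates $\mathrm{move}$ at the pair $(c_0,E)$ given by the current colors of $v$ and of its neighbors. If the value is $\mathrm{Stop}$, the run ends. If it is $(c_1,d)$, then $v$ gets the color $c_1$ and the adversary moves the agent to a neighbor of $v$ of color $d$ of the adversary's choice. The algorithm successfully explores $G$ if for every adversary, after finitely many steps, every vertex has been visited by the agent, the agent is on $v_0$, and the decision is $\mathrm{Stop}$. Theorem. For every algorithm that successfully explores all finite connected simple graphs and for every integer $n\ge 1$, there are a connected simple graph $G$ with $n$ vertices and an adversary such that, in the resulting run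 on $G$, the algorithm assigns at least $n-1$ pairwise different nonzero colors to vertices of $G$. -/

import Mathlib

namespace GraphExploration

/-- The local view of the agent: the colour of the current vertex and, for every colour `c`, the
number of neighbours of colour `c`. Colour `0` means "uncoloured". -/
abbrev Env : Type := ℕ × (ℕ →₀ ℕ)

/-- A (zero-memory) algorithm. `move e = none` is the decision to stop; `move e = some (c₁, d)` is
the decision to give the current vertex the colour `c₁` and to go to a neighbour of colour `d`. -/
structure Algorithm where
  move : Env → Option (ℕ × ℕ)
  /-- The agent is never sent to a neighbour that does not exist. -/
  exists_neighbor : ∀ (c₀ : ℕ) (E : ℕ →₀ ℕ) (c₁ d : ℕ), move (c₀, E) = some (c₁, d) → 0 < E d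
  /-- A coloured vertex is never recoloured. -/
  no_recolor : ∀ (c₀ : ℕ) (E : ℕ →₀ ℕ) (c₁ d : ℕ),
    move (c₀, E) = some (c₁, d) → c₀ ≠ 0 → c₁ = c₀

/-- A configuration: the position of the agent and the current colouring of the vertices. -/
structure Config (V : Type) where
  pos : V
  col : V → ℕ

open Classical in
/-- The environment seen from the vertex `v` of `G` under the colouring `col`. -/
noncomputable def env {V : Type} [Fintype V] (G : SimpleGraph V) (col : V → ℕ) (v : V) : Env :=
  (col v,
    Finsupp.onFinset (Finset.univ.image col)
      (fun c => (Finset.univ.filter fun w => G.Adj v w ∧ col w = c).card)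
      (by
        intro c hc
        obtain ⟨w, hw⟩ := Finset.card_ne_zero.mp hc
        exact Finset.mem_image.mpr ⟨w, Finset.mem_univ w, (Finset.mem_filter.mp hw).2.2⟩))

/-- The decision of the algorithm in the configuration `s`. -/
noncomputable def Algorithm.decision (A : Algorithm) {V : Type} [Fintype V] (G : SimpleGraph V)
    (s : Config V) : Option (ℕ × ℕ) :=
  A.move (env G s.col s.pos)

open Classical in
/-- `t` can follow `s` in one step: the algorithm decides on `(c₁, d)`, the current vertex gets the
colour `c₁`, and the agent moves to some neighbour of colour `d` (the choice of this neighbour is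
made by the adversary). -/
def Algorithm.Step (A : Algorithm) {V : Type} [Fintype V] (G : SimpleGraph V)
    (s t : Config V) : Prop :=
  ∃ c₁ d : ℕ, A.decision G s = some (c₁, d) ∧
    t.col = Function.update s.col s.pos c₁ ∧ G.Adj s.pos t.pos ∧ s.col t.pos = d

/-- `s` is a run of the algorithm on `G` against some adversary. All vertices are uncoloured
initially, the start vertex `(s 0).pos` is arbitrary (it is chosen by the adversary), and each
configuration arises from the one before by a step; once the algorithm has decided to stop, the
configuration is repeated forever. -/
structure Algorithm.IsRun (A : Algorithm) {V : Type} [Fintype V] (G : SimpleGraph V)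
    (s : ℕ → Config V) : Prop where
  uncolored : ∀ v : V, (s 0).col v = 0
  next : ∀ k : ℕ, A.Step G (s k) (s (k + 1)) ∨ (A.decision G (s k) = none ∧ s (k + 1) = s k)

/-- The algorithm successfully explores `G`: for every adversary, after finitely many steps the
algorithm stops with the agent on the start vertex, all vertices having been visited. -/
def Algorithm.Explores (A : Algorithm) {V : Type} [Fintype V] (G : SimpleGraph V) : Prop :=
  ∀ s : ℕ → Config V, A.IsRun G s →
    ∃ T : ℕ, A.decision G (s T) = none ∧ (s T).pos = (s 0).pos ∧
      ∀ v : V, ∃ k ≤ T, (s k).pos = v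

/-- The algorithm successfully explores all (finite, connected, simple) graphs. -/
def Algorithm.ExploresAll (A : Algorithm) : Prop :=
  ∀ (V : Type) [Fintype V] (G : SimpleGraph V), G.Connected → A.Explores G

/-- The colours used in a run; `0` is not counted as a colour. -/
def colorsUsed {V : Type} (s : ℕ → Config V) : Set ℕ :=
  {c | c ≠ 0 ∧ ∃ (k : ℕ) (v : V), (s k).col v = c}

end GraphExploration

/-!
The adversary plays on a complete graph. On every newly visited vertex, as long as a further vertex
is unvisited, the agent has to choose a colour that is nonzero and new; afterwards all visited
vertices are coloured, so that an adversary who keeps the agent among them whenever possible is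
finally sent to an unvisited vertex.

If the vertex stayed uncoloured, then this adversary could keep the agent among the visited vertices
forever. If the vertex `u` received the colour of another vertex `v`, then the same would happen on
the clique of the visited vertices with some leaves attached to each of them, since the agent has
not seen any difference so far. There `u` and `v` become twins. A leaf sees nothing but the colour
of its neighbour, so leaves visited at `u` and `v` look alike, and the views from the twins differ
at most in the numbers of their uncoloured leaves. Every visit of a leaf has to colour it, because
otherwise it would be repeated forever. The adversary now replaces all moves to one twin `y` by
moves to the other twin `x`, so that the leaves at `y` remain unvisited, until the agent on `x`
decides to go to a vertex of the colour of `x` itself. Then the agent is let go to `y`, and from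
there on kept away from `x` until as many leaves are uncoloured at `y` as at `x`. At that time `y`
offers the same view as `x`, so the agent goes back and forth between the twins forever.
-/

namespace GraphExploration

open Function Relation

section Runs

theorem exists_seq_of_reflTransGen {α : Type*} {r : α → α → Prop} (hr : ∀ a, ∃ b, r a b) {a b : α}
    (hab : ReflTransGen r a b) :
    ∃ s : ℕ → α, s 0 = a ∧ (∀ k, r (s k) (s (k + 1))) ∧ ∃ k, s k = b := by
  induction hab using ReflTransGen.head_induction_on with
  | refl =>
    choose next hnext using hr
    exact ⟨fun k => next^[k] b, rfl, fun k => by simpa only [iterate_succ_apply'] using hnext _,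
      0, rfl⟩
  | @head a a' haa' _ ih =>
    obtain ⟨s, hs₀, hs, k, hk⟩ := ih
    exact ⟨fun k => Nat.casesOn k a s, rfl,
      fun k => Nat.casesOn k (by simpa only [hs₀] using haa') hs, k + 1, hk⟩

variable {A : Algorithm} {V : Type}

/-- A configuration together with the set of the vertices visited so far. -/
structure State (V : Type) extends Config V where
  visited : Set V

/-- The initial state with the agent on `v₀`. -/
def State.start (v₀ : V) : State V := ⟨⟨v₀, fun _ => 0⟩, {v₀}⟩

open Classical in
/-- The state after the agent has given its vertex the colour `c` and has moved to `w`. -/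
noncomputable def State.moveTo (p : State V) (w : V) (c : ℕ) : State V :=
  ⟨⟨w, update p.col p.pos c⟩, insert w p.visited⟩

/-- The state after the agent has moved to `w` without any change of colours. -/
def State.walkTo (p : State V) (w : V) : State V := ⟨⟨w, p.col⟩, insert w p.visited⟩

theorem State.moveTo_col [DecidableEq V] (p : State V) (w : V) (c : ℕ) :
    (p.moveTo w c).col = update p.col p.pos c := by
  rw [moveTo]
  convert rfl

theorem State.moveTo_col_pos (p : State V) (w : V) : p.moveTo w (p.col p.pos) = p.walkTo w := by
  simp only [moveTo, walkTo, update_eq_self]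

variable [Fintype V] {G : SimpleGraph V}

/-- A step of the algorithm, together with the bookkeeping of the visited vertices. -/
def Algorithm.VStep (A : Algorithm) (G : SimpleGraph V) (p q : State V) : Prop :=
  A.Step G p.toConfig q.toConfig ∧ q.visited = insert q.pos p.visited

/-- A step of the algorithm, or the repetition of a state in which it has decided to stop. -/
def Algorithm.Next (A : Algorithm) (G : SimpleGraph V) (p q : State V) : Prop :=
  A.VStep G p q ∨ A.decision G p.toConfig = none ∧ q = p

/-- The state `p` arises after finitely many steps from the start vertex `v₀` against some
adversary. -/
def Algorithm.Reach (A : Algorithm) (G : SimpleGraph V) (v₀ : V) (p : State V) : Prop :=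
  ReflTransGen (A.VStep G) (State.start v₀) p

open Classical in
theorem env_snd_apply (G : SimpleGraph V) (col : V → ℕ) (v : V) (c : ℕ) :
    (env G col v).2 c = (Finset.univ.filter fun w => G.Adj v w ∧ col w = c).card := rfl

theorem env_congr {col col' : V → ℕ} {v : V} (hv : col v = col' v)
    (hadj : ∀ w, G.Adj v w → col w = col' w) : env G col v = env G col' v := by
  refine Prod.ext hv (Finsupp.ext fun c => ?_)
  classical
  rw [env_snd_apply, env_snd_apply]
  exact congrArg Finset.card (Finset.filter_congr fun w _ =>
    and_congr_right fun hw => by rw [hadj w hw])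

theorem decision_congr {W : Type} [Fintype W] {H : SimpleGraph W} {s : Config V} {t : Config W}
    (h : env G s.col s.pos = env H t.col t.pos) : A.decision G s = A.decision H t :=
  congrArg A.move h

theorem exists_adj_of_decision {s : Config V} {c d : ℕ} (h : A.decision G s = some (c, d)) :
    ∃ w, G.Adj s.pos w ∧ s.col w = d := by
  classical
  have hpos : 0 < (env G s.col s.pos).2 d := A.exists_neighbor _ _ _ _ h
  rw [env_snd_apply, Finset.card_pos] at hpos
  obtain ⟨w, hw⟩ := hpos
  exact ⟨w, (Finset.mem_filter.mp hw).2⟩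

theorem eq_col_of_decision {s : Config V} {c d : ℕ} (h : A.decision G s = some (c, d))
    (hcol : s.col s.pos ≠ 0) : c = s.col s.pos :=
  A.no_recolor _ _ _ _ h hcol

theorem vstep_moveTo {p : State V} {w : V} {c : ℕ}
    (h : A.decision G p.toConfig = some (c, p.col w)) (hw : G.Adj p.pos w) :
    A.VStep G p (p.moveTo w c) :=
  ⟨⟨c, _, h, rfl, hw, rfl⟩, rfl⟩

theorem vstep_walkTo {p : State V} {w : V}
    (h : A.decision G p.toConfig = some (p.col p.pos, p.col w)) (hw : G.Adj p.pos w) :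
    A.VStep G p (p.walkTo w) :=
  p.moveTo_col_pos w ▸ vstep_moveTo h hw

theorem Algorithm.exists_next (A : Algorithm) (G : SimpleGraph V) (p : State V) :
    ∃ q, A.Next G p q := by
  rcases hd : A.decision G p.toConfig with _ | ⟨c, d⟩
  · exact ⟨p, Or.inr ⟨hd, rfl⟩⟩
  · obtain ⟨w, hw, rfl⟩ := exists_adj_of_decision hd
    exact ⟨_, Or.inl (vstep_moveTo hd hw)⟩

theorem Algorithm.Next.visited_subset {p q : State V} (h : A.Next G p q) :
    p.visited ⊆ q.visited := by
  rcases h with ⟨-, hq⟩ | ⟨-, rfl⟩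
  · exact hq ▸ Set.subset_insert _ _
  · exact subset_rfl

theorem Algorithm.Next.pos_mem {p q : State V} (h : A.Next G p q) (hp : p.pos ∈ p.visited) :
    q.pos ∈ q.visited := by
  rcases h with ⟨-, hq⟩ | ⟨-, rfl⟩
  · exact hq ▸ Set.mem_insert _ _
  · exact hp

section Sequences

variable {v₀ : V} {s : ℕ → State V}

theorem isRun_of_next (hs₀ : s 0 = State.start v₀) (hs : ∀ k, A.Next G (s k) (s (k + 1))) :
    A.IsRun G fun k => (s k).toConfig where
  uncolored v := by rw [hs₀]; rfl
  next k := (hs k).imp And.left (And.imp_right (congrArg State.toConfig))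

theorem pos_mem_visited_of_next (hs₀ : s 0 = State.start v₀)
    (hs : ∀ k, A.Next G (s k) (s (k + 1))) {i k : ℕ} (hik : i ≤ k) :
    (s i).pos ∈ (s k).visited := by
  have hmono : Monotone fun k => (s k).visited :=
    monotone_nat_of_le_succ fun k => (hs k).visited_subset
  have hmem : ∀ j, (s j).pos ∈ (s j).visited := fun j => by
    induction j with
    | zero => rw [hs₀]; exact Set.mem_singleton v₀
    | succ j ih => exact (hs j).pos_mem ih
  exact hmono hik (hmem i)

theorem eq_of_next_of_decision_eq_none (hs : ∀ k, A.Next G (s k) (s (k + 1))) {i k : ℕ}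
    (hi : A.decision G (s i).toConfig = none) (hik : i ≤ k) : s k = s i := by
  induction k, hik using Nat.le_induction with
  | base => rfl
  | succ k _ ih =>
    rcases hs k with ⟨⟨c, d, hd, -⟩, -⟩ | ⟨-, hk⟩
    · rw [ih, hi] at hd
      contradiction
    · exact hk.trans ih

theorem Algorithm.Explores.exists_decision_eq_none (hE : A.Explores G)
    (hs₀ : s 0 = State.start v₀) (hs : ∀ k, A.Next G (s k) (s (k + 1))) :
    ∃ T, A.decision G (s T).toConfig = none ∧ (s T).pos = v₀ ∧ (s T).visited = Set.univ := by
  obtain ⟨T, hT, hpos, hall⟩ := hE _ (isRun_of_next hs₀ hs)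
  refine ⟨T, hT, hpos.trans (by rw [hs₀]; rfl), Set.eq_univ_of_forall fun v => ?_⟩
  obtain ⟨k, hk, rfl⟩ := hall v
  exact pos_mem_visited_of_next hs₀ hs hk

end Sequences

end Runs

section Reach

variable {A : Algorithm} {V : Type} [Fintype V] {G : SimpleGraph V} {v₀ : V} {p q : State V}

theorem Algorithm.Reach.trans (hp : A.Reach G v₀ p) (hpq : TransGen (A.VStep G) p q) :
    A.Reach G v₀ q :=
  ReflTransGen.trans hp hpq.to_reflTransGen

theorem Algorithm.Reach.exists_seq (hp : A.Reach G v₀ p) :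
    ∃ s : ℕ → State V, s 0 = State.start v₀ ∧ (∀ k, A.Next G (s k) (s (k + 1))) ∧ ∃ k, s k = p :=
  exists_seq_of_reflTransGen (A.exists_next G) (ReflTransGen.mono (fun _ _ => Or.inl) _ _ hp)

theorem Algorithm.Reach.pos_mem (hp : A.Reach G v₀ p) : p.pos ∈ p.visited := by
  obtain ⟨s, hs₀, hs, k, rfl⟩ := hp.exists_seq
  exact pos_mem_visited_of_next hs₀ hs le_rfl

theorem Algorithm.Reach.start_mem (hp : A.Reach G v₀ p) : v₀ ∈ p.visited := by
  obtain ⟨s, hs₀, hs, k, rfl⟩ := hp.exists_seq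
  have hmem := pos_mem_visited_of_next hs₀ hs (Nat.zero_le k)
  rwa [hs₀] at hmem

theorem Algorithm.Reach.col_eq_zero (hp : A.Reach G v₀ p) {v : V} (hv : v ∉ p.visited) :
    p.col v = 0 := by
  induction hp with
  | refl => rfl
  | tail hp hstep ih =>
    obtain ⟨⟨c, d, -, hcol, -⟩, hvisited⟩ := hstep
    have hv' := fun h => hv (hvisited ▸ Set.mem_insert_of_mem _ h)
    have hpos : v ≠ _ := fun h => hv' (h ▸ Algorithm.Reach.pos_mem hp)
    classical
    rw [hcol, update_of_ne hpos, ih hv']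

theorem Algorithm.Explores.pos_and_visited_of_decision_eq_none (hE : A.Explores G)
    (hp : A.Reach G v₀ p) (hd : A.decision G p.toConfig = none) :
    p.pos = v₀ ∧ p.visited = Set.univ := by
  obtain ⟨s, hs₀, hs, k, rfl⟩ := hp.exists_seq
  obtain ⟨T, hT, hpos, hvisited⟩ := hE.exists_decision_eq_none hs₀ hs
  have hkT : s k = s T := by
    rcases le_total k T with h | h
    · exact (eq_of_next_of_decision_eq_none hs hd h).symm
    · exact eq_of_next_of_decision_eq_none hs hT h
  exact hkT ▸ ⟨hpos, hvisited⟩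

theorem Algorithm.Explores.acc (hE : A.Explores G) (hp : A.Reach G v₀ p) :
    Acc (swap (A.VStep G)) p := by
  induction hp with
  | refl =>
    by_contra hacc
    obtain ⟨s, hs₀, hs⟩ := not_acc_iff_exists_descending_chain.mp hacc
    obtain ⟨T, hT, -⟩ := hE.exists_decision_eq_none hs₀ fun k => Or.inl (hs k)
    obtain ⟨c, d, hd, -⟩ := (hs T).1
    rw [hT] at hd
    contradiction
  | tail _ hstep ih => exact ih.inv hstep

theorem Algorithm.Explores.not_trap (hE : A.Explores G) {Trap : State V → Prop}
    (h : ∀ p, A.Reach G v₀ p → Trap p → (∃ q, TransGen (A.VStep G) p q ∧ Trap q) ∨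
      A.decision G p.toConfig = none ∧ p.visited ≠ Set.univ)
    (hp : A.Reach G v₀ p) : ¬ Trap p := by
  induction (hE.acc hp).transGen with
  | intro p _ ih =>
    intro hTrap
    rcases h p hp hTrap with ⟨q, hpq, hq⟩ | ⟨hd, hvisited⟩
    · exact ih q (transGen_swap.mpr hpq) (hp.trans hpq) hq
    · exact hvisited (hE.pos_and_visited_of_decision_eq_none hp hd).2

/-- The adversary leads the agent through visited vertices without change of colours as long as
possible. -/
theorem Algorithm.Explores.exists_exit (hE : A.Explores G) (hp : A.Reach G v₀ p)
    (hvisited : p.visited ≠ Set.univ) :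
    ∃ q, A.Reach G v₀ q ∧ q.col = p.col ∧ q.visited = p.visited ∧
      ∃ c d, A.decision G q.toConfig = some (c, d) ∧
        (c = q.col q.pos → ∀ w ∈ q.visited, G.Adj q.pos w → q.col w ≠ d) := by
  by_contra! hno
  refine hE.not_trap (Trap := fun q => q.col = p.col ∧ q.visited = p.visited) ?_ hp ⟨rfl, rfl⟩
  rintro q hq ⟨hcol, hvis⟩
  rcases hd : A.decision G q.toConfig with _ | ⟨c, d⟩
  · exact Or.inr ⟨rfl, hvis ▸ hvisited⟩
  · obtain ⟨rfl, w, hw, hadj, rfl⟩ := hno q hq hcol hvis c d hd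
    exact Or.inl ⟨q.walkTo w, .single (vstep_walkTo hd hadj), hcol,
      (Set.insert_eq_of_mem hw).trans hvis⟩

end Reach

section PendantClique

/-- The complete graph on `ι` with a leaf `(i, some k)` for every `k : κ` attached to each vertex
`(i, none)` of the clique. -/
def pendantClique (ι κ : Type) : SimpleGraph (ι × Option κ) where
  Adj p q := (p.2 = none ∧ q.2 = none ∧ p.1 ≠ q.1) ∨
    (p.1 = q.1 ∧ (p.2 = none ∧ q.2 ≠ none ∨ p.2 ≠ none ∧ q.2 = none))
  symm := ⟨by
    rintro p q (⟨hp, hq, hne⟩ | ⟨heq, hpq⟩)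
    · exact Or.inl ⟨hq, hp, hne.symm⟩
    · exact Or.inr ⟨heq.symm, by tauto⟩⟩
  loopless := ⟨by
    rintro p (⟨-, -, hne⟩ | ⟨-, hpp⟩)
    · exact hne rfl
    · tauto⟩

variable {A : Algorithm} {ι κ : Type} {i j : ι} {k l : κ}

@[simp]
theorem pendantClique_adj_none_none : (pendantClique ι κ).Adj (i, none) (j, none) ↔ i ≠ j := by
  simp [pendantClique]

@[simp]
theorem pendantClique_adj_none_some : (pendantClique ι κ).Adj (i, none) (j, some k) ↔ i = j := by
  simp [pendantClique]

@[simp]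
theorem pendantClique_adj_some_none : (pendantClique ι κ).Adj (i, some k) (j, none) ↔ i = j := by
  simp [pendantClique]

@[simp]
theorem not_pendantClique_adj_some_some : ¬ (pendantClique ι κ).Adj (i, some k) (j, some l) := by
  simp [pendantClique]

theorem pendantClique_connected [Nonempty ι] : (pendantClique ι κ).Connected := by
  have hclique : ∀ i j : ι, (pendantClique ι κ).Reachable (i, none) (j, none) := fun i j => by
    by_cases h : i = j
    · rw [h]
    · exact (pendantClique_adj_none_none.mpr h).reachable
  have hleaf : ∀ v : ι × Option κ, (pendantClique ι κ).Reachable v (v.1, none) := by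
    rintro ⟨i, _ | k⟩
    · rfl
    · exact (pendantClique_adj_some_none.mpr rfl).reachable
  exact ⟨fun v w => (hleaf v).trans ((hclique _ _).trans (hleaf w).symm)⟩

theorem card_filter_ne_and_eq_of_eq {V : Type*} [Fintype V] [DecidableEq V] {col : V → ℕ} {u v : V}
    (h : col u = col v) (c : ℕ) :
    (Finset.univ.filter fun w => u ≠ w ∧ col w = c).card =
      (Finset.univ.filter fun w => v ≠ w ∧ col w = c).card := by
  have herase : ∀ u, (Finset.univ.filter fun w => u ≠ w ∧ col w = c) =
      (Finset.univ.filter fun w => col w = c).erase u := fun u => by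
    ext w
    simp [eq_comm]
  simp only [herase, Finset.card_erase_eq_ite, Finset.mem_filter, Finset.mem_univ, true_and, h]

theorem card_filter_eq_of_eq_zero_or_eq {κ : Type*} [Fintype κ] {f g : κ → ℕ} {a : ℕ}
    (hf : ∀ k, f k = 0 ∨ f k = a) (hg : ∀ k, g k = 0 ∨ g k = a)
    (h : (Finset.univ.filter fun k => f k = 0).card = (Finset.univ.filter fun k => g k = 0).card)
    (c : ℕ) :
    (Finset.univ.filter fun k => f k = c).card = (Finset.univ.filter fun k => g k = c).card := by
  have hcount : ∀ e : κ → ℕ, (∀ k, e k = 0 ∨ e k = a) →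
      (Finset.univ.filter fun k => e k = c).card =
        if c = 0 then (Finset.univ.filter fun k => e k = 0).card
        else if c = a then Fintype.card κ - (Finset.univ.filter fun k => e k = 0).card
        else 0 := fun e he => by
    split_ifs with h₀ ha
    · rw [h₀]
    · have hsum := Finset.card_filter_add_card_filter_not (s := Finset.univ) (fun k => e k = 0)
      have hfilter : (Finset.univ.filter fun k => e k = c) =
          Finset.univ.filter fun k => ¬ e k = 0 := Finset.filter_congr fun k _ => by grind
      rw [hfilter, ← Finset.card_univ]
      omega
    · exact Finset.card_eq_zero.mpr (Finset.filter_eq_empty_iff.mpr fun k _ => by grind)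
  rw [hcount f hf, hcount g hg, h]

/-- The colour of a leaf after a visit of the agent, if it had the colour `a` before and is attached
to a vertex of colour `b`. If the agent stops on the leaf, the colour remains `a`. -/
noncomputable def Algorithm.leafColor (A : Algorithm) (b a : ℕ) : ℕ :=
  ((A.move (a, Finsupp.single b 1)).map Prod.fst).getD a

theorem Algorithm.leafColor_of_ne_zero {a : ℕ} (b : ℕ) (ha : a ≠ 0) : A.leafColor b a = a := by
  unfold leafColor
  rcases hm : A.move (a, Finsupp.single b 1) with _ | ⟨c, d⟩
  · rfl
  · exact A.no_recolor _ _ _ _ hm ha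

/-- The leaves at `(i, none)` are uncoloured or have the colour that they receive in a visit made
after the vertex `(i, none)` has got its present colour. -/
def Algorithm.RegularLeaves (A : Algorithm) (col : ι × Option κ → ℕ) (i : ι) : Prop :=
  ∀ k, col (i, some k) = 0 ∨ col (i, some k) = A.leafColor (col (i, none)) 0

theorem Algorithm.RegularLeaves.update_leaf [DecidableEq (ι × Option κ)] {col : ι × Option κ → ℕ}
    (h : A.RegularLeaves col j) (i : ι) (k : κ) :
    A.RegularLeaves (update col (i, some k) (A.leafColor (col (i, none)) 0)) j := by
  intro l
  rw [update_of_ne (a := (j, none)) (by simp)]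
  by_cases hl : (j, some l) = (i, some k)
  · obtain rfl : j = i := congrArg Prod.fst hl
    rw [hl, update_self]
    exact Or.inr rfl
  · rw [update_of_ne hl]
    exact h l

variable [Fintype κ]

/-- The number of uncoloured leaves at `(i, none)`. -/
def uncoloredLeaves (col : ι × Option κ → ℕ) (i : ι) : ℕ :=
  (Finset.univ.filter fun k => col (i, some k) = 0).card

theorem uncoloredLeaves_update_of_ne [DecidableEq (ι × Option κ)] (col : ι × Option κ → ℕ) (k : κ)
    (c : ℕ) (hij : j ≠ i) :
    uncoloredLeaves (update col (i, some k) c) j = uncoloredLeaves col j := by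
  simp only [uncoloredLeaves, ne_eq, Prod.mk.injEq, hij, false_and, not_false_eq_true, update_of_ne]

theorem uncoloredLeaves_update_self [DecidableEq (ι × Option κ)] {col : ι × Option κ → ℕ} {c : ℕ}
    (hk : col (i, some k) = 0) (hc : c ≠ 0) :
    uncoloredLeaves (update col (i, some k) c) i + 1 = uncoloredLeaves col i := by
  classical
  have herase : (Finset.univ.filter fun l => update col (i, some k) c (i, some l) = 0) =
      (Finset.univ.filter fun l => col (i, some l) = 0).erase k := by
    ext l
    by_cases hl : l = k <;> simp [hl, hc]
  rw [uncoloredLeaves, herase]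
  exact Finset.card_erase_add_one (by simpa using hk)

variable [Fintype ι]

open Classical in
theorem env_pendantClique_none_snd (col : ι × Option κ → ℕ) (i : ι) (c : ℕ) :
    (env (pendantClique ι κ) col (i, none)).2 c =
      (Finset.univ.filter fun j => i ≠ j ∧ col (j, none) = c).card +
      (Finset.univ.filter fun k => col (i, some k) = c).card := by
  rw [env_snd_apply]
  simp only [Finset.card_filter, Fintype.sum_prod_type, Fintype.sum_option, Finset.sum_add_distrib,
    pendantClique_adj_none_none, pendantClique_adj_none_some]
  congr 1
  rw [Fintype.sum_eq_single i fun j hj => by simp [hj.symm]]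
  simp

theorem env_pendantClique_some (col : ι × Option κ → ℕ) (i : ι) (k : κ) :
    env (pendantClique ι κ) col (i, some k) =
      (col (i, some k), Finsupp.single (col (i, none)) 1) := by
  classical
  refine Prod.ext rfl (Finsupp.ext fun c => ?_)
  rw [env_snd_apply]
  simp only [Finset.card_filter, Fintype.sum_prod_type, Fintype.sum_option,
    pendantClique_adj_some_none, not_pendantClique_adj_some_some, Finsupp.single_apply]
  rw [Fintype.sum_eq_single i fun j hj => by simp [hj.symm]]
  simp

theorem env_pendantClique_eq_of_eq {col : ι × Option κ → ℕ} (hcol : col (i, none) = col (j, none))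
    (hi : A.RegularLeaves col i) (hj : A.RegularLeaves col j)
    (h : uncoloredLeaves col i = uncoloredLeaves col j) :
    env (pendantClique ι κ) col (i, none) = env (pendantClique ι κ) col (j, none) := by
  classical
  refine Prod.ext hcol (Finsupp.ext fun c => ?_)
  have hleaves := card_filter_eq_of_eq_zero_or_eq (hcol ▸ hi) hj h c
  rw [env_pendantClique_none_snd, env_pendantClique_none_snd,
    card_filter_ne_and_eq_of_eq (col := fun l => col (l, none)) hcol]
  convert congrArg _ hleaves

end PendantClique

section LeafTrips

variable {A : Algorithm} {ι κ : Type} {i j r : ι} {k : κ} {p : State (ι × Option κ)}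

/-- The state after the agent, standing on `(i, none)`, has gone to the leaf `(i, some k)` and
back. -/
noncomputable def Algorithm.leafTrip (A : Algorithm) (p : State (ι × Option κ)) (i : ι) (k : κ) :
    State (ι × Option κ) :=
  (p.walkTo (i, some k)).moveTo (i, none) (A.leafColor (p.col (i, none)) (p.col (i, some k)))

theorem some_mem_visited_leafTrip {l : κ} :
    (j, some l) ∈ (A.leafTrip p i k).visited ↔ (j, some l) = (i, some k) ∨
      (j, some l) ∈ p.visited := by
  simp [Algorithm.leafTrip, State.moveTo, State.walkTo]

theorem some_mem_visited_leafTrip_of_ne {l : κ} (hij : j ≠ i) :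
    (j, some l) ∈ (A.leafTrip p i k).visited ↔ (j, some l) ∈ p.visited := by
  simp [some_mem_visited_leafTrip, hij]

variable [Fintype ι] [Fintype κ] {c : ℕ}

theorem vstep_of_pos_eq_some (hE : A.Explores (pendantClique ι κ))
    (hp : A.Reach (pendantClique ι κ) (r, none) p)
    (hpos : p.pos = (i, some k)) :
    A.VStep (pendantClique ι κ) p
      (p.moveTo (i, none) (A.leafColor (p.col (i, none)) (p.col (i, some k)))) := by
  rcases hd : A.decision (pendantClique ι κ) p.toConfig with _ | ⟨c, d⟩
  · have hstart := (hE.pos_and_visited_of_decision_eq_none hp hd).1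
    simp [hpos] at hstart
  obtain ⟨⟨j, _ | l⟩, hadj, rfl⟩ := exists_adj_of_decision hd
  · rw [hpos, pendantClique_adj_some_none] at hadj
    subst hadj
    have hmove := hd
    rw [Algorithm.decision, hpos, env_pendantClique_some] at hmove
    simp only [Algorithm.leafColor, hmove, Option.map_some, Option.getD_some]
    exact vstep_moveTo hd (by simp [hpos])
  · simp [hpos] at hadj

theorem transGen_leafTrip (hE : A.Explores (pendantClique ι κ))
    (hp : A.Reach (pendantClique ι κ) (r, none) p) (hpos : p.pos = (i, none))
    (hcol : p.col (i, none) ≠ 0)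
    (hd : A.decision (pendantClique ι κ) p.toConfig = some (c, p.col (i, some k))) :
    TransGen (A.VStep (pendantClique ι κ)) p (A.leafTrip p i k) := by
  have hc : c = p.col p.pos := eq_col_of_decision hd (by rwa [hpos])
  have hstep : A.VStep (pendantClique ι κ) p (p.walkTo (i, some k)) :=
    vstep_walkTo (hc ▸ hd) (by simp [hpos])
  exact .tail (.single hstep) (vstep_of_pos_eq_some hE (hp.tail hstep) rfl)

theorem leafColor_ne_of_decision (hE : A.Explores (pendantClique ι κ))
    (hp : A.Reach (pendantClique ι κ) (r, none) p) (hpos : p.pos = (i, none))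
    (hcol : p.col (i, none) ≠ 0)
    (hd : A.decision (pendantClique ι κ) p.toConfig = some (c, p.col (i, some k))) :
    A.leafColor (p.col (i, none)) (p.col (i, some k)) ≠ p.col (i, some k) := by
  intro heq
  have hsame : (A.leafTrip p i k).toConfig = p.toConfig := by
    simp only [Algorithm.leafTrip, State.moveTo, State.walkTo, heq, update_eq_self]
    rw [← hpos]
  refine hE.not_trap (Trap := fun q => q.toConfig = p.toConfig) ?_ hp rfl
  intro q hq hqp
  have htrip := transGen_leafTrip hE hq (hqp ▸ hpos) (by rwa [hqp]) (by rwa [hqp])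
  have hback : (A.leafTrip q i k).toConfig = (A.leafTrip p i k).toConfig := by
    simp only [Algorithm.leafTrip, State.moveTo, State.walkTo, hqp]
  exact Or.inl ⟨_, htrip, hback.trans hsame⟩

/-- A visit of a leaf that does not change its colour would be repeated forever. -/
theorem col_leaf_eq_zero_of_decision (hE : A.Explores (pendantClique ι κ))
    (hp : A.Reach (pendantClique ι κ) (r, none) p) (hpos : p.pos = (i, none))
    (hcol : p.col (i, none) ≠ 0)
    (hd : A.decision (pendantClique ι κ) p.toConfig = some (c, p.col (i, some k))) :
    p.col (i, some k) = 0 ∧ A.leafColor (p.col (i, none)) 0 ≠ 0 := by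
  have hne := leafColor_ne_of_decision hE hp hpos hcol hd
  have h₀ : p.col (i, some k) = 0 := by
    by_contra h₀
    exact hne (A.leafColor_of_ne_zero _ h₀)
  exact ⟨h₀, by rwa [h₀] at hne⟩

/-- The adversary replaces a move to `(y, none)` by a move to `(x, none)`. -/
theorem exists_walkTo_or_leafTrip (hE : A.Explores (pendantClique ι κ))
    (hp : A.Reach (pendantClique ι κ) (r, none) p) (hpos : p.pos = (i, none))
    (hcol : p.col (i, none) ≠ 0) {x y : ι} {d : ℕ} (hxy : x ≠ y)
    (hcolxy : p.col (x, none) = p.col (y, none))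
    (hd : A.decision (pendantClique ι κ) p.toConfig = some (c, d))
    (hcross : ¬ (i = x ∧ d = p.col (x, none))) :
    (∃ j ≠ y, TransGen (A.VStep (pendantClique ι κ)) p (p.walkTo (j, none))) ∨
      ∃ k, p.col (i, some k) = 0 ∧ A.leafColor (p.col (i, none)) 0 ≠ 0 ∧
        TransGen (A.VStep (pendantClique ι κ)) p (A.leafTrip p i k) := by
  obtain rfl : c = p.col p.pos := eq_col_of_decision hd (by rwa [hpos])
  obtain ⟨⟨j, _ | k⟩, hadj, rfl⟩ := exists_adj_of_decision hd
  · rw [hpos, pendantClique_adj_none_none] at hadj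
    left
    by_cases hjy : j = y
    · subst hjy
      have hix : i ≠ x := fun h => hcross ⟨h, hcolxy.symm⟩
      exact ⟨x, hxy, .single (vstep_walkTo (by rwa [hcolxy]) (by simp [hpos, hix]))⟩
    · exact ⟨j, hjy, .single (vstep_walkTo hd (by simp [hpos, hadj]))⟩
  · rw [hpos, pendantClique_adj_none_some] at hadj
    subst hadj
    obtain ⟨h₀, hcolor⟩ := col_leaf_eq_zero_of_decision hE hp hpos hcol hd
    exact Or.inr ⟨k, h₀, hcolor, transGen_leafTrip hE hp hpos hcol hd⟩

end LeafTrips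

section Twins

variable {A : Algorithm} {ι κ : Type} {i r x y : ι} {col : ι × Option κ → ℕ}

/-- All clique vertices are coloured, and `(x, none)` and `(y, none)` have the same colour and
regular leaves: the agent can tell them apart only by the numbers of their uncoloured leaves. -/
structure Algorithm.Twins (A : Algorithm) (col : ι × Option κ → ℕ) (x y : ι) : Prop where
  ne : x ≠ y
  colored : ∀ i, col (i, none) ≠ 0
  color_eq : col (x, none) = col (y, none)
  regular_left : A.RegularLeaves col x
  regular_right : A.RegularLeaves col y

theorem Algorithm.Twins.symm (h : A.Twins col x y) : A.Twins col y x where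
  ne := h.ne.symm
  colored := h.colored
  color_eq := h.color_eq.symm
  regular_left := h.regular_right
  regular_right := h.regular_left

theorem twins_update [DecidableEq (ι × Option κ)] (hxy : x ≠ y)
    (hcol : ∀ i ≠ x, col (i, none) ≠ 0) (hleaf : ∀ i k, col (i, some k) = 0) :
    A.Twins (update col (x, none) (col (y, none))) x y where
  ne := hxy
  colored i := by
    by_cases hi : i = x
    · rw [hi, update_self]
      exact hcol y hxy.symm
    · rw [update_of_ne (by simpa using hi)]
      exact hcol i hi
  color_eq := by rw [update_self, update_of_ne (by simpa using hxy.symm)]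
  regular_left k := Or.inl (by simp [hleaf])
  regular_right k := Or.inl (by simp [hleaf])

theorem Algorithm.Twins.update_leaf [DecidableEq (ι × Option κ)] (h : A.Twins col x y) (i : ι)
    (k : κ) : A.Twins (update col (i, some k) (A.leafColor (col (i, none)) 0)) x y where
  ne := h.ne
  colored := by simpa using h.colored
  color_eq := by simpa using h.color_eq
  regular_left := h.regular_left.update_leaf i k
  regular_right := h.regular_right.update_leaf i k

variable {p : State (ι × Option κ)}

theorem leafTrip_col [DecidableEq (ι × Option κ)] {k : κ} (hk : p.col (i, some k) = 0) :
    (A.leafTrip p i k).col = update p.col (i, some k) (A.leafColor (p.col (i, none)) 0) := by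
  rw [Algorithm.leafTrip, State.moveTo_col, hk]
  rfl

/-- The adversary keeps the agent away from `(y, none)` and its leaves. -/
structure Algorithm.IsolatedTwin (A : Algorithm) (p : State (ι × Option κ)) (x y : ι) : Prop where
  twins : A.Twins p.col x y
  pos : ∃ i ≠ y, p.pos = (i, none)
  notMem_visited : ∀ k, (y, some k) ∉ p.visited

theorem Algorithm.IsolatedTwin.walkTo (h : A.IsolatedTwin p x y) (hi : i ≠ y) :
    A.IsolatedTwin (p.walkTo (i, none)) x y where
  twins := h.twins
  pos := ⟨i, hi, rfl⟩
  notMem_visited k hk := h.notMem_visited k (by simpa [State.walkTo] using hk)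

theorem Algorithm.IsolatedTwin.leafTrip (h : A.IsolatedTwin p x y) (hi : i ≠ y) {k : κ}
    (hk : p.col (i, some k) = 0) : A.IsolatedTwin (A.leafTrip p i k) x y where
  twins := by
    classical
    exact leafTrip_col (A := A) hk ▸ h.twins.update_leaf i k
  pos := ⟨i, hi, rfl⟩
  notMem_visited l hl := h.notMem_visited l ((some_mem_visited_leafTrip_of_ne hi.symm).mp hl)

variable [Fintype ι] [Fintype κ]

/-- The agent, standing on `(i, none)`, decides to go to a vertex of the colour of `(i, none)`. -/
def Algorithm.Crosses (A : Algorithm) (col : ι × Option κ → ℕ) (i : ι) : Prop :=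
  A.decision (pendantClique ι κ) ⟨(i, none), col⟩ = some (col (i, none), col (i, none))

theorem crosses_iff_of_pos_eq (hpos : p.pos = (i, none)) :
    A.Crosses p.col i ↔ A.decision (pendantClique ι κ) p.toConfig =
      some (p.col (i, none), p.col (i, none)) := by
  rw [Algorithm.Crosses, ← hpos]

theorem Algorithm.Crosses.update_leaf_of_ne [DecidableEq (ι × Option κ)] (h : A.Crosses col x)
    (hxi : x ≠ i) (k : κ) (c : ℕ) : A.Crosses (update col (i, some k) c) x := by
  have hcol : ∀ j, update col (i, some k) c (j, none) = col (j, none) := by simp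
  have henv : env (pendantClique ι κ) (update col (i, some k) c) (x, none) =
      env (pendantClique ι κ) col (x, none) := by
    refine env_congr (hcol x) ?_
    rintro ⟨j, _ | l⟩ hadj
    · exact hcol j
    · obtain rfl : x = j := by simpa using hadj
      exact update_of_ne (by simp [hxi]) _ _
  rw [Crosses, hcol]
  exact (decision_congr henv).trans h

theorem Algorithm.Twins.crosses (h : A.Twins col x y) (hx : A.Crosses col x)
    (hcount : uncoloredLeaves col x = uncoloredLeaves col y) : A.Crosses col y := by
  rw [Crosses, ← h.color_eq, ← hx]
  exact (decision_congr (env_pendantClique_eq_of_eq h.color_eq h.regular_left h.regular_right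
    hcount)).symm

/-- The adversary lets the agent go back and forth between the two vertices. -/
theorem pos_ne_of_crosses (hE : A.Explores (pendantClique ι κ))
    (hp : A.Reach (pendantClique ι κ) (r, none) p) (hxy : x ≠ y)
    (hcol : p.col (x, none) = p.col (y, none)) (hx : A.Crosses p.col x) (hy : A.Crosses p.col y) :
    p.pos ≠ (x, none) := by
  intro hpos
  refine hE.not_trap (Trap := fun q => q.col = p.col ∧ (q.pos = (x, none) ∨ q.pos = (y, none)))
    ?_ hp ⟨rfl, Or.inl hpos⟩
  rintro q - ⟨hq, hpos | hpos⟩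
  · have hd := (crosses_iff_of_pos_eq hpos).mp (hq ▸ hx)
    exact Or.inl ⟨q.walkTo (y, none), .single (vstep_walkTo (by rw [hd, hpos, hq, hcol])
      (by simp [hpos, hxy])), hq, Or.inr rfl⟩
  · have hd := (crosses_iff_of_pos_eq hpos).mp (hq ▸ hy)
    exact Or.inl ⟨q.walkTo (x, none), .single (vstep_walkTo (by rw [hd, hpos, hq, hcol])
      (by simp [hpos, hxy.symm])), hq, Or.inl rfl⟩

/-- The agent has left `(x, none)` towards its twin `(y, none)`. The adversary does not let it
return to `(x, none)` before equally many leaves are uncoloured at both twins. -/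
structure Algorithm.WaitingTwin (A : Algorithm) (p : State (ι × Option κ)) (x y : ι) : Prop where
  twins : A.Twins p.col x y
  crosses : A.Crosses p.col x
  pos : ∃ i ≠ x, p.pos = (i, none)
  col_ne_zero_of_visited : ∀ k, (y, some k) ∈ p.visited → p.col (y, some k) ≠ 0
  lt : uncoloredLeaves p.col x < uncoloredLeaves p.col y

theorem Algorithm.WaitingTwin.visited_ne_univ (h : A.WaitingTwin p x y) :
    p.visited ≠ Set.univ := by
  obtain ⟨k, hk⟩ := Finset.card_pos.mp ((Nat.zero_le _).trans_lt h.lt)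
  exact fun huniv => h.col_ne_zero_of_visited k (huniv ▸ Set.mem_univ _)
    (Finset.mem_filter.mp hk).2

theorem Algorithm.WaitingTwin.walkTo (h : A.WaitingTwin p x y) (hi : i ≠ x) :
    A.WaitingTwin (p.walkTo (i, none)) x y where
  twins := h.twins
  crosses := h.crosses
  pos := ⟨i, hi, rfl⟩
  col_ne_zero_of_visited k hk := h.col_ne_zero_of_visited k (by simpa [State.walkTo] using hk)
  lt := h.lt

theorem Algorithm.WaitingTwin.leafTrip (h : A.WaitingTwin p x y) (hi : i ≠ x) {k : κ}
    (hk : p.col (i, some k) = 0) (hcolor : A.leafColor (p.col (i, none)) 0 ≠ 0) :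
    A.WaitingTwin (A.leafTrip p i k) x y ∨ i = y ∧
      uncoloredLeaves (A.leafTrip p i k).col x = uncoloredLeaves (A.leafTrip p i k).col y := by
  classical
  have hcol := leafTrip_col (A := A) hk
  have hx : uncoloredLeaves (A.leafTrip p i k).col x = uncoloredLeaves p.col x := by
    rw [hcol, uncoloredLeaves_update_of_ne _ _ _ hi.symm]
  have hwaiting (hlt : uncoloredLeaves (A.leafTrip p i k).col x <
      uncoloredLeaves (A.leafTrip p i k).col y) : A.WaitingTwin (A.leafTrip p i k) x y :=
    { twins := hcol ▸ h.twins.update_leaf i k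
      crosses := hcol ▸ h.crosses.update_leaf_of_ne hi.symm k _
      pos := ⟨i, hi, rfl⟩
      col_ne_zero_of_visited := fun l hl => by
        rw [hcol]
        by_cases hlk : (y, some l) = (i, some k)
        · rwa [hlk, update_self]
        · rw [update_of_ne hlk]
          exact h.col_ne_zero_of_visited l ((some_mem_visited_leafTrip.mp hl).resolve_left hlk)
      lt := hlt }
  have hlt := h.lt
  by_cases hiy : i = y
  · subst hiy
    have hy : uncoloredLeaves (A.leafTrip p i k).col i + 1 = uncoloredLeaves p.col i := by
      rw [hcol, uncoloredLeaves_update_self hk hcolor]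
    rcases (show uncoloredLeaves (A.leafTrip p i k).col x ≤
      uncoloredLeaves (A.leafTrip p i k).col i by omega).lt_or_eq with hlt | heq
    · exact Or.inl (hwaiting hlt)
    · exact Or.inr ⟨rfl, heq⟩
  · have hy : uncoloredLeaves (A.leafTrip p i k).col y = uncoloredLeaves p.col y := by
      rw [hcol, uncoloredLeaves_update_of_ne _ _ _ (Ne.symm hiy)]
    exact Or.inl (hwaiting (by omega))

theorem not_waitingTwin (hE : A.Explores (pendantClique ι κ))
    (hp : A.Reach (pendantClique ι κ) (r, none) p) : ¬ A.WaitingTwin p x y := by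
  refine hE.not_trap (Trap := fun p => A.WaitingTwin p x y) ?_ hp
  intro p hp h
  rcases hd : A.decision (pendantClique ι κ) p.toConfig with _ | ⟨c, d⟩
  · exact Or.inr ⟨rfl, h.visited_ne_univ⟩
  left
  obtain ⟨i, hi, hpos⟩ := h.pos
  have hnotcross : ¬ (i = y ∧ d = p.col (y, none)) := by
    rintro ⟨rfl, rfl⟩
    have hc := eq_col_of_decision hd (hpos ▸ h.twins.colored i)
    rw [hc, hpos] at hd
    exact pos_ne_of_crosses hE hp hi h.twins.color_eq.symm ((crosses_iff_of_pos_eq hpos).mpr hd)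
      h.crosses hpos
  rcases exists_walkTo_or_leafTrip hE hp hpos (h.twins.colored i) h.twins.ne.symm
    h.twins.color_eq.symm hd hnotcross with ⟨j, hj, hreach⟩ | ⟨k, hk, hcolor, hreach⟩
  · exact ⟨_, hreach, h.walkTo hj⟩
  rcases h.leafTrip hi hk hcolor with htrip | ⟨rfl, hcount⟩
  · exact ⟨_, hreach, htrip⟩
  · classical
    have hcol := leafTrip_col (A := A) hk
    have htwins : A.Twins (A.leafTrip p i k).col x i := hcol ▸ h.twins.update_leaf i k
    have hx : A.Crosses (A.leafTrip p i k).col x :=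
      hcol ▸ h.crosses.update_leaf_of_ne hi.symm k _
    exact absurd rfl (pos_ne_of_crosses hE (hp.trans hreach) hi htwins.color_eq.symm
      (htwins.crosses hx hcount) hx)

theorem Algorithm.IsolatedTwin.not_crosses (hE : A.Explores (pendantClique ι κ))
    (hp : A.Reach (pendantClique ι κ) (r, none) p) (h : A.IsolatedTwin p x y)
    (hpos : p.pos = (x, none)) : ¬ A.Crosses p.col x := by
  intro hx
  have hcount : uncoloredLeaves p.col x ≤ uncoloredLeaves p.col y := by
    have hy : uncoloredLeaves p.col y = Fintype.card κ := by
      simp only [uncoloredLeaves, hp.col_eq_zero (h.notMem_visited _), Finset.filter_true,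
        Finset.card_univ]
    exact hy ▸ Finset.card_le_univ _
  rcases hcount.lt_or_eq with hlt | heq
  · have hd := (crosses_iff_of_pos_eq hpos).mp hx
    have hstep : A.VStep (pendantClique ι κ) p (p.walkTo (y, none)) :=
      vstep_walkTo (by rw [hd, hpos, h.twins.color_eq]) (by simp [hpos, h.twins.ne])
    refine not_waitingTwin hE (hp.tail hstep) (x := x) (y := y)
      ⟨h.twins, hx, ⟨y, h.twins.ne.symm, rfl⟩, fun k hk => ?_, hlt⟩
    exact absurd (by simpa [State.walkTo] using hk) (h.notMem_visited k)
  · exact pos_ne_of_crosses hE hp h.twins.ne h.twins.color_eq hx (h.twins.crosses hx heq) hpos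

theorem not_isolatedTwin [Nonempty κ] (hE : A.Explores (pendantClique ι κ))
    (hp : A.Reach (pendantClique ι κ) (r, none) p) : ¬ A.IsolatedTwin p x y := by
  refine hE.not_trap (Trap := fun p => A.IsolatedTwin p x y) ?_ hp
  intro p hp h
  rcases hd : A.decision (pendantClique ι κ) p.toConfig with _ | ⟨c, d⟩
  · obtain ⟨k⟩ := ‹Nonempty κ›
    exact Or.inr ⟨rfl, fun huniv => h.notMem_visited k (huniv ▸ Set.mem_univ _)⟩
  left
  obtain ⟨i, hi, hpos⟩ := h.pos
  have hnotcross : ¬ (i = x ∧ d = p.col (x, none)) := by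
    rintro ⟨rfl, rfl⟩
    have hc := eq_col_of_decision hd (hpos ▸ h.twins.colored i)
    rw [hc, hpos] at hd
    exact h.not_crosses hE hp hpos ((crosses_iff_of_pos_eq hpos).mpr hd)
  rcases exists_walkTo_or_leafTrip hE hp hpos (h.twins.colored i) h.twins.ne h.twins.color_eq hd
    hnotcross with ⟨j, hj, hreach⟩ | ⟨k, hk, -, hreach⟩
  · exact ⟨_, hreach, h.walkTo hj⟩
  · exact ⟨_, hreach, h.leafTrip hi hk⟩

/-- If the agent repeated the colour of `(v, none)`, then the adversary could turn the two vertices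
into twins one of which is isolated. -/
theorem decision_ne_repeated_color [Nonempty κ] (hE : A.Explores (pendantClique ι κ))
    (hp : A.Reach (pendantClique ι κ) (r, none) p) {u v : ι} (huv : u ≠ v)
    (hpos : p.pos = (u, none)) (hcol : ∀ i ≠ u, p.col (i, none) ≠ 0)
    (hvisited : ∀ i k, (i, some k) ∉ p.visited) (d : ℕ) :
    A.decision (pendantClique ι κ) p.toConfig ≠ some (p.col (v, none), d) := by
  classical
  intro hd
  have hleaf : ∀ i k, p.col (i, some k) = 0 := fun i k => hp.col_eq_zero (hvisited i k)
  obtain ⟨w, hadj, rfl⟩ := exists_adj_of_decision hd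
  have hstep := vstep_moveTo hd hadj
  have hq := hp.tail hstep
  have htwins : A.Twins (p.moveTo w (p.col (v, none))).col u v := by
    rw [State.moveTo_col, hpos]
    exact twins_update huv hcol hleaf
  obtain ⟨j, _ | k⟩ := w
  · rw [hpos, pendantClique_adj_none_none] at hadj
    exact not_isolatedTwin hE hq (x := v) (y := u) ⟨htwins.symm, ⟨j, hadj.symm, rfl⟩, fun k hk =>
      hvisited u k (by simpa [State.moveTo] using hk)⟩
  · rw [hpos, pendantClique_adj_none_some] at hadj
    subst hadj
    have hback := vstep_of_pos_eq_some hE hq rfl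
    refine not_isolatedTwin hE (hq.tail hback) (x := u) (y := v) ⟨?_, ⟨u, huv, rfl⟩, fun l hl =>
      hvisited v l (by simpa [State.moveTo, huv.symm] using hl)⟩
    have hk : (p.moveTo (u, some k) (p.col (v, none))).col (u, some k) = 0 := by
      simp [State.moveTo, hpos, hleaf]
    rw [State.moveTo_col, hk]
    exact htwins.update_leaf u k

end Twins

section CompleteGraph

variable {A : Algorithm} {V : Type}

/-- The colouring of the pendant clique on `S` that agrees with `col` on the clique and leaves the
pendant vertices uncoloured. -/
def cliqueColoring (S : Set V) (col : V → ℕ) : S × Option ↥Sᶜ → ℕ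
  | (v, none) => col v
  | (_, some _) => 0

theorem cliqueColoring_update [DecidableEq V] {S : Set V} [DecidableEq (S × Option ↥Sᶜ)]
    (col : V → ℕ) {v : V} (hv : v ∈ S) (c : ℕ) :
    cliqueColoring S (update col v c) = update (cliqueColoring S col) (⟨v, hv⟩, none) c := by
  funext ⟨w, k⟩
  rcases k with _ | k
  · by_cases hw : w = ⟨v, hv⟩
    · simp [cliqueColoring, hw]
    · have hw' : (w : V) ≠ v := fun h => hw (Subtype.ext h)
      simp [cliqueColoring, hw, hw']
  · simp [cliqueColoring]

/-- The agent, having visited pairwise differently coloured vertices, has just arrived on an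
uncoloured vertex. -/
structure Fresh (p : State V) : Prop where
  col_pos : p.col p.pos = 0
  injOn : Set.InjOn p.col (support p.col)
  visited_eq : p.visited = insert p.pos (support p.col)

theorem Fresh.of_update [DecidableEq V] {p q : State V} (hF : Fresh p) {c : ℕ} (hc : c ≠ 0)
    (hnew : ∀ v, p.col v ≠ c) (hcol : q.col = update p.col p.pos c)
    (hvisited : q.visited = insert q.pos p.visited) (hpos : q.pos ∉ p.visited) :
    Fresh q ∧ support q.col = insert p.pos (support p.col) := by
  have hsupport : support q.col = insert p.pos (support p.col) := by
    rw [hcol, support_update_of_ne_zero _ _ hc]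
  refine ⟨⟨?_, ?_, ?_⟩, hsupport⟩
  · rwa [hF.visited_eq, ← hsupport, notMem_support] at hpos
  · have hne : ∀ v ∈ support p.col, v ≠ p.pos := fun v hv h => hv (h ▸ hF.col_pos)
    have heq : Set.EqOn p.col q.col (support p.col) := fun v hv => by
      rw [hcol, update_of_ne (hne v hv)]
    rw [hsupport, Set.injOn_insert fun h => hne _ h rfl]
    refine ⟨hF.injOn.congr heq, ?_⟩
    rintro ⟨v, hv, hvc⟩
    rw [← heq hv, hcol, update_self] at hvc
    exact hnew v hvc
  · rw [hvisited, hF.visited_eq, hsupport]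

variable [Fintype V]

theorem env_top_congr {col : V → ℕ} {u v : V} (h : col u = col v) :
    env (⊤ : SimpleGraph V) col u = env ⊤ col v := by
  classical
  refine Prod.ext h (Finsupp.ext fun c => ?_)
  rw [env_snd_apply, env_snd_apply]
  convert card_filter_ne_and_eq_of_eq h c

theorem env_cliqueColoring {S : Set V} [Fintype S] [Fintype ↥Sᶜ] {col : V → ℕ}
    (hcol : ∀ w ∉ S, col w = 0) {v : V} (hv : v ∈ S) :
    env (pendantClique S ↥Sᶜ) (cliqueColoring S col) (⟨v, hv⟩, none) = env ⊤ col v := by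
  classical
  refine Prod.ext rfl (Finsupp.ext fun c => ?_)
  rw [env_pendantClique_none_snd, env_snd_apply, Finset.card_filter, Finset.card_filter,
    Finset.card_filter, ← Fintype.sum_subtype_add_sum_subtype (fun w => w ∈ S)]
  congr 1
  · refine Finset.sum_congr (by ext; simp) fun w _ => ?_
    simp [cliqueColoring, Subtype.ext_iff]
  · refine Finset.sum_congr (by ext; simp) fun w _ => ?_
    have hvw : v ≠ w := fun h => w.2 (h ▸ hv)
    simp only [cliqueColoring, hcol w w.2, SimpleGraph.top_adj, ne_eq, hvw, not_false_eq_true,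
      true_and]
    congr

variable {v₀ : V} {p : State V}

/-- As long as the agent stays in `S`, it cannot distinguish the complete graph from the pendant
clique on `S`. -/
theorem Algorithm.Reach.exists_reach_pendantClique {S : Set V} [Fintype S] [Fintype ↥Sᶜ]
    (hp : A.Reach ⊤ v₀ p) (hv₀ : v₀ ∈ S) (hS : p.visited ⊆ S) :
    ∃ (hpos : p.pos ∈ S) (q : State (S × Option ↥Sᶜ)),
      A.Reach (pendantClique S ↥Sᶜ) (⟨v₀, hv₀⟩, none) q ∧ q.pos = (⟨p.pos, hpos⟩, none) ∧
      q.col = cliqueColoring S p.col ∧ ∀ i k, (i, some k) ∉ q.visited := by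
  classical
  induction hp with
  | refl =>
    refine ⟨hv₀, State.start (⟨v₀, hv₀⟩, none), ReflTransGen.refl, rfl, ?_, by simp [State.start]⟩
    funext ⟨i, k⟩
    cases k <;> rfl
  | @tail p p' hp hstep ih =>
    obtain ⟨⟨c, d, hd, hcol, hadj, hcold⟩, hvisited⟩ := hstep
    rw [hvisited, Set.insert_subset_iff] at hS
    obtain ⟨hpos, q, hq, hqpos, hqcol, hqvisited⟩ := ih hS.2
    have henv := env_cliqueColoring
      (fun w hw => Algorithm.Reach.col_eq_zero hp fun hw' => hw (hS.2 hw')) hpos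
    rw [← hqcol, ← hqpos] at henv
    have hqd : A.decision (pendantClique S ↥Sᶜ) q.toConfig =
        some (c, q.col (⟨p'.pos, hS.1⟩, none)) := by
      rw [decision_congr henv, hd, hqcol]
      exact congrArg (fun d => some (c, d)) hcold.symm
    have hqadj : (pendantClique S ↥Sᶜ).Adj q.pos (⟨p'.pos, hS.1⟩, none) := by
      simpa [hqpos] using hadj
    refine ⟨hS.1, _, hq.tail (vstep_moveTo hqd hqadj), rfl, ?_, ?_⟩
    · rw [State.moveTo_col, hqpos, hqcol, hcol, cliqueColoring_update _ hpos]
    · simpa [State.moveTo] using hqvisited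

/-- Otherwise the adversary could keep the agent among the uncoloured vertices, which look all the
same. -/
theorem Algorithm.Explores.decision_ne_zero_zero (hE : A.Explores (⊤ : SimpleGraph V))
    (hp : A.Reach ⊤ v₀ p) (hpos : p.col p.pos = 0) : A.decision ⊤ p.toConfig ≠ some (0, 0) := by
  intro hd
  refine hE.not_trap (Trap := fun q => q.col = p.col ∧ q.col q.pos = 0) ?_ hp ⟨rfl, hpos⟩
  rintro q - ⟨hcol, hqpos⟩
  have hqd : A.decision ⊤ q.toConfig = some (0, 0) := by
    rw [← hd]
    exact decision_congr (hcol ▸ env_top_congr (hqpos.trans (hcol ▸ hpos).symm))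
  obtain ⟨w, hadj, hw⟩ := exists_adj_of_decision hqd
  exact Or.inl ⟨q.walkTo w, .single (vstep_walkTo (by rw [hqd, hqpos, hw]) hadj), hcol, hw⟩

theorem Fresh.color_ne_zero (hF : Fresh p) (hE : A.Explores (⊤ : SimpleGraph V))
    (hp : A.Reach ⊤ v₀ p) (hvisited : p.visited ≠ Set.univ) {c d : ℕ}
    (hd : A.decision ⊤ p.toConfig = some (c, d)) : c ≠ 0 := by
  rintro rfl
  obtain ⟨w, hadj, rfl⟩ := exists_adj_of_decision hd
  have hw : p.col w ≠ 0 := fun hw =>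
    hE.decision_ne_zero_zero hp hF.col_pos (hd.trans (by rw [hw]))
  obtain ⟨q, hq, hcol, hvis, c, d, hqd, hexit⟩ := hE.exists_exit hp hvisited
  have hmem : ∀ v, v ∈ q.visited ↔ v = p.pos ∨ p.col v ≠ 0 := fun v => by
    rw [hvis, hF.visited_eq, Set.mem_insert_iff, mem_support]
  by_cases hpos : q.pos = p.pos
  · have hcd : some (c, d) = some (0, p.col w) := by
      rw [← hqd, ← hd]
      exact decision_congr (by rw [hcol, hpos])
    obtain ⟨rfl, rfl⟩ := Prod.mk.inj (Option.some.inj hcd)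
    exact hexit (by rw [hcol, hpos, hF.col_pos]) w ((hmem w).mpr (Or.inr hw)) (hpos ▸ hadj)
      (by rw [hcol])
  · have hqpos : q.col q.pos ≠ 0 := hcol ▸ ((hmem _).mp hq.pos_mem).resolve_left hpos
    have hc := eq_col_of_decision hqd hqpos
    obtain ⟨w', hadj', rfl⟩ := exists_adj_of_decision hqd
    have hw' : q.col w' = 0 := hq.col_eq_zero fun hw' => hexit hc w' hw' hadj' rfl
    exact hexit hc p.pos ((hmem _).mpr (Or.inl rfl)) hpos (by rw [hw', hcol, hF.col_pos])

theorem Fresh.color_ne (hF : Fresh p) (hE : A.ExploresAll) (hp : A.Reach ⊤ v₀ p)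
    (hvisited : p.visited ≠ Set.univ) {c d : ℕ} (hd : A.decision ⊤ p.toConfig = some (c, d))
    (v : V) : p.col v ≠ c := by
  classical
  rintro rfl
  have : Nonempty V := ⟨v⟩
  have hcolor := hF.color_ne_zero (hE V ⊤ SimpleGraph.connected_top) hp hvisited hd
  have hcol : ∀ w ∉ p.visited, p.col w = 0 := fun w hw => hp.col_eq_zero hw
  obtain ⟨hpos, q, hq, hqpos, hqcol, hqvisited⟩ :=
    hp.exists_reach_pendantClique hp.start_mem subset_rfl
  have hv : v ∈ p.visited := not_imp_comm.mp (hcol v) hcolor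
  have : Nonempty ↥p.visited := ⟨⟨v, hv⟩⟩
  have : Nonempty ↥p.visitedᶜ := (Set.nonempty_compl.mpr hvisited).to_subtype
  have hne : (⟨p.pos, hpos⟩ : p.visited) ≠ ⟨v, hv⟩ := fun h =>
    hcolor ((congrArg (p.col ·.1) h).symm.trans hF.col_pos)
  refine decision_ne_repeated_color (hE _ _ pendantClique_connected) hq hne hqpos ?_ hqvisited d ?_
  · intro i hi
    have hi' : (i : V) ≠ p.pos := fun h => hi (Subtype.ext h)
    rw [hqcol]
    exact (hF.visited_eq ▸ i.2 : (i : V) ∈ insert p.pos (support p.col)).resolve_left hi'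
  · rw [hqcol]
    refine (decision_congr ?_).trans hd
    rw [hqcol, hqpos]
    exact env_cliqueColoring hcol hpos

/-- Since a coloured vertex is never recoloured, an adversary who prefers visited vertices has to
let the agent out at some point. -/
theorem Algorithm.Explores.exists_reach_unvisited (hE : A.Explores (⊤ : SimpleGraph V))
    (hp : A.Reach ⊤ v₀ p) (hvisited : p.visited ≠ Set.univ) (hcol : ∀ v ∈ p.visited, p.col v ≠ 0) :
    ∃ q, A.Reach ⊤ v₀ q ∧ q.col = p.col ∧ q.visited = insert q.pos p.visited ∧
      q.pos ∉ p.visited := by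
  obtain ⟨q, hq, hqcol, hqvisited, c, d, hd, hexit⟩ := hE.exists_exit hp hvisited
  have hc : c = q.col q.pos :=
    eq_col_of_decision hd (hqcol ▸ hcol _ (hqvisited ▸ hq.pos_mem))
  obtain ⟨w, hadj, rfl⟩ := exists_adj_of_decision hd
  exact ⟨q.walkTo w, hq.tail (vstep_walkTo (hc ▸ hd) hadj), hqcol,
    congrArg (insert w) hqvisited, fun hw => hexit hc w (hqvisited ▸ hw) hadj rfl⟩

theorem Fresh.exists_reach_support_eq_insert (hF : Fresh p) (hE : A.ExploresAll)
    (hp : A.Reach ⊤ v₀ p) (hvisited : p.visited ≠ Set.univ) :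
    ∃ q, A.Reach ⊤ v₀ q ∧ Fresh q ∧ support q.col = insert p.pos (support p.col) := by
  classical
  have : Nonempty V := ⟨v₀⟩
  have hT : A.Explores (⊤ : SimpleGraph V) := hE V ⊤ SimpleGraph.connected_top
  rcases hd : A.decision ⊤ p.toConfig with _ | ⟨c, d⟩
  · exact absurd (hT.pos_and_visited_of_decision_eq_none hp hd).2 hvisited
  have hc := hF.color_ne_zero hT hp hvisited hd
  have hnew := hF.color_ne hE hp hvisited hd
  obtain ⟨w, hadj, rfl⟩ := exists_adj_of_decision hd
  have hreach : A.Reach ⊤ v₀ (p.moveTo w c) := hp.tail (vstep_moveTo hd hadj)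
  have hcol : (p.moveTo w c).col = update p.col p.pos c := p.moveTo_col w c
  by_cases hw : w ∈ p.visited
  · have hvis : (p.moveTo w c).visited = p.visited := Set.insert_eq_of_mem hw
    have hcolored : ∀ v ∈ (p.moveTo w c).visited, (p.moveTo w c).col v ≠ 0 := fun v hv => by
      rwa [hvis, hF.visited_eq, ← support_update_of_ne_zero _ _ hc, ← hcol] at hv
    obtain ⟨q, hq, hqcol, hqvis, hqpos⟩ :=
      hT.exists_reach_unvisited hreach (hvis ▸ hvisited) hcolored
    rw [hvis] at hqvis hqpos
    exact ⟨q, hq, hF.of_update hc hnew (hqcol.trans hcol) hqvis hqpos⟩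
  · exact ⟨_, hreach, hF.of_update hc hnew hcol rfl hw⟩

theorem exists_reach_fresh (hE : A.ExploresAll) (v₀ : V) {t : ℕ} (ht : t < Fintype.card V) :
    ∃ p, A.Reach ⊤ v₀ p ∧ Fresh p ∧ (support p.col).encard = t := by
  induction t with
  | zero =>
    have hsupport : support (State.start v₀).col = ∅ := support_zero
    refine ⟨State.start v₀, ReflTransGen.refl, ⟨rfl, ?_, ?_⟩, ?_⟩
    · simp [hsupport]
    · rw [hsupport, insert_empty_eq]
      rfl
    · simp [hsupport]
  | succ t ih =>
    obtain ⟨p, hp, hF, hcard⟩ := ih (Nat.lt_of_succ_lt ht)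
    have hinsert : (insert p.pos (support p.col)).encard = t + 1 := by
      rw [Set.encard_insert_of_notMem (notMem_support.mpr hF.col_pos), hcard]
    have hvisited : p.visited ≠ Set.univ := fun huniv => by
      rw [← hF.visited_eq, huniv, Set.encard_univ, ENat.card_eq_coe_fintype_card] at hinsert
      exact ht.ne (by exact_mod_cast hinsert.symm)
    obtain ⟨q, hq, hFq, hsupport⟩ := hF.exists_reach_support_eq_insert hE hp hvisited
    exact ⟨q, hq, hFq, by rw [hsupport, hinsert, Nat.cast_succ]⟩

end CompleteGraph

end GraphExploration

open GraphExploration in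
theorem mainTheorem1_general (A : Algorithm) (hA : A.ExploresAll) {V : Type} [Fintype V] (v₀ : V) :
    ∃ s : ℕ → Config V, A.IsRun ⊤ s ∧ (s 0).pos = v₀ ∧
      ((Fintype.card V - 1 : ℕ) : ℕ∞) ≤ (colorsUsed s).encard := by
  obtain ⟨p, hp, hF, hcard⟩ := exists_reach_fresh hA v₀
    (Nat.sub_lt (Fintype.card_pos_iff.mpr ⟨v₀⟩) Nat.one_pos)
  obtain ⟨s, hs₀, hs, k, rfl⟩ := hp.exists_seq
  refine ⟨fun k => (s k).toConfig, isRun_of_next hs₀ hs, congrArg (·.pos) hs₀, ?_⟩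
  rw [← hcard, ← hF.injOn.encard_image]
  refine Set.encard_le_encard ?_
  rintro _ ⟨v, hv, rfl⟩
  exact ⟨hv, k, v, rfl⟩

theorem mainTheorem1 (A : GraphExploration.Algorithm) (hA : A.ExploresAll) (n : ℕ) (hn : 1 ≤ n) :
    ∃ G : SimpleGraph (Fin n), G.Connected ∧
      ∃ s : ℕ → GraphExploration.Config (Fin n), A.IsRun G s ∧
        ((n - 1 : ℕ) : ℕ∞) ≤ (GraphExploration.colorsUsed s).encard := by
  have : NeZero n := NeZero.of_pos hn
  obtain ⟨s, hs, -, hcard⟩ := mainTheorem1_general A hA (0 : Fin n)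
  exact ⟨⊤, SimpleGraph.connected_top, s, hs, by rwa [Fintype.card_fin] at hcard⟩
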